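/- A (finite) hypergraph $G=(V,E)$ consists of a finite vertex set $V$ and a set $E$ of subsets of $V$, called edges. It is $t$-intersecting if $|e\cap e'|\ge t$ for any two distinct edges $e,e'\in E$. A $c$-strong coloring of $G$ is an assignment of colors to the vertices such that every edge $e$ contains vertices of at least $\min\{c,|e|\}$ distinct colors. For integers $c\ge 2$ and $t\ge 0$, let $\chi(t,c)\in\mathbb{N}\cup\{\infty\}$ be the least number of colors that suffices to $c$-strong color every $t$-intersecting hypergraph ($\infty$ if no finite number suffices). Theorem. Let $t\ge c\ge 2$ be integers, and let $\ell$ be an integer with $$\ell>(c-1)(t+1)\qquad\text{and}\qquad \binom{\ell}{c-1}\left(\frac{c-1}{\ell}\right)^{t}<1 .$$ Then every $t$-intersecting hypergraph has a $c$-strong coloring with at most $\ell$ colors; that is, $\chi(t,c)\le \ell$. Moreover, $\ell=t^t$ satisfies both conditions, and so $\chi(t,c)$ is finite for all $t\ge c\ge 2$. -/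

import Mathlib

namespace SemiStrong

/-- A hypergraph is `t`-intersecting if any two of its (distinct) edges have at least `t` vertices
in common. -/
def IsIntersecting {α : Type*} (t : ℕ) (G : Hypergraph α) : Prop :=
  G.edgeSet.Pairwise fun e e' => (t : ℕ∞) ≤ (e ∩ e').encard

/-- An assignment of colors to the vertices of `G` is a `c`-strong coloring if every edge `e` covers
vertices of at least `min {c, |e|}` distinct colors. -/
def IsStrongColoring {α κ : Type*} (c : ℕ) (G : Hypergraph α) (f : G.vertexSet → κ) : Prop :=
  ∀ e ∈ G.edgeSet, min (c : ℕ∞) e.encard ≤ (f '' {v | (v : α) ∈ e}).encard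

/-- `G` has a `c`-strong coloring with (at most) `k` colors. -/
def StrongColorable {α : Type*} (c k : ℕ) (G : Hypergraph α) : Prop :=
  ∃ f : G.vertexSet → Fin k, IsStrongColoring c G f

/-- `k` colors suffice to `c`-strong color any finite `t`-intersecting hypergraph. -/
def Suffices (t c k : ℕ) : Prop :=
  ∀ (α : Type) (G : Hypergraph α), G.vertexSet.Finite → IsIntersecting t G → StrongColorable c k G

/-- The `c`-strong chromatic number `χ(t, c)` of `t`-intersecting hypergraphs: the least number of
colors that suffices to `c`-strong color any `t`-intersecting hypergraph, and `⊤` (infinity) if no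
finite number suffices. -/
noncomputable def chi (t c : ℕ) : ℕ∞ :=
  ⨅ (k : ℕ) (_ : Suffices t c k), (k : ℕ∞)

end SemiStrong

namespace SemiStrong

open Finset Polynomial

/-! Color the vertices uniformly at random with `ℓ` colors. An edge with fewer than `c` colors lies
in the preimage of some set `K` of `c - 1` colors. That preimage is a `p`-biased random set, `p = (c
- 1) / ℓ`, and the supersets of edges form a `t`-intersecting family. So a union bound over `K`
suffices once such a family has measure `m ≤ p ^ t` (`sum_biasedWeight_le_pow`).

For that bound, let `W(ρ)` be the probability that two `ρ`-correlated `p`-biased sets both lie in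
the family, as a formal polynomial in `ρ`. Then `W(0) = m ^ 2` and `W(1) = m`; the coefficients are
sums of squares, and `W` vanishes to order `t` at `-p / (1 - p)`. With `r = (1 - p) / p`,
`pow_mul_eval_zero_le_eval_one` gives `m ^ 2 ≤ p ^ t * m`. -/

/-! ### Truncated binomial sums -/

/-- The truncated binomial expansion of `(1 - (1 + r)) ^ n` has coefficients of constant sign in
powers of `r`. -/
lemma truncated_binomial_eq_sum_pow (r : ℝ) {s n : ℕ} (h : s < n) :
    (-1) ^ s * ∑ i ∈ range (s + 1), (n.choose i : ℝ) * (-(1 + r)) ^ i =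
      ∑ j ∈ range (s + 1), (n.choose j : ℝ) * ((n - 1 - j).choose (s - j) : ℝ) * r ^ j := by
  have expand : ∀ i ∈ range (s + 1), (n.choose i : ℝ) * (-(1 + r)) ^ i =
      ∑ j ∈ range (i + 1), (-1) ^ i * (n.choose j : ℝ) * ((n - j).choose (i - j) : ℝ) * r ^ j := by
    intro i hi
    rw [neg_pow, add_comm, add_pow, mul_sum, mul_sum]
    refine sum_congr rfl fun j hj => ?_
    have := congrArg (Nat.cast (R := ℝ))
      (Nat.choose_mul (n := n) (k := i) (s := j) (by simp at hj; omega))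
    push_cast at this
    linear_combination (-1) ^ i * r ^ j * this
  rw [sum_congr rfl expand, mul_sum]
  simp_rw [mul_sum]
  rw [sum_comm' (t' := range (s + 1)) (s' := fun j => Ico j (s + 1))
    (by intro i j; simp only [mem_range, mem_Ico]; omega)]
  refine sum_congr rfl fun j hj => ?_
  have hj : j ≤ s := by simpa [Nat.lt_succ_iff] using hj
  rw [sum_Ico_eq_sum_range]
  have alt := congrArg (Int.cast (R := ℝ))
    (Int.alternating_sum_range_choose_eq_choose (n := n - 1 - j) (m := s - j))
  push_cast at alt
  rw [show n - 1 - j + 1 = n - j by omega, show s - j + 1 = s + 1 - j by omega] at alt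
  have sgn : (-1 : ℝ) ^ s * (-1) ^ j * (-1) ^ (s - j) = 1 := by
    rw [← pow_add, ← pow_add]
    exact Even.neg_one_pow ⟨s, by omega⟩
  calc _ = (-1) ^ s * (-1) ^ j * n.choose j * r ^ j *
        ∑ m ∈ range (s + 1 - j), (-1) ^ m * ((n - j).choose m : ℝ) := by
        rw [mul_sum]
        refine sum_congr rfl fun m _ => ?_
        rw [Nat.add_sub_cancel_left, pow_add]; ring
    _ = _ := by rw [alt]; linear_combination (n.choose j * r ^ j * (n - 1 - j).choose (s - j)) * sgn

/-- Bounds the growth of each coefficient of `r ^ j` from `n` to `n + 1` by `n / (n - s)`, uniformly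
in `j`. -/
lemma choose_mul_choose_succ_le {j s n : ℕ} (hj : j ≤ s) (h : s < n) :
    ((n : ℝ) - s) * ((n + 1).choose j * (n - j).choose (s - j)) ≤
      n * (n.choose j * (n - 1 - j).choose (s - j)) := by
  have e1 := congrArg (Nat.cast (R := ℝ)) (Nat.choose_mul_succ_eq n j)
  have e2 := congrArg (Nat.cast (R := ℝ)) (Nat.choose_mul_succ_eq (n - 1 - j) (s - j))
  rw [show n - 1 - j + 1 = n - j by omega, show n - j - (s - j) = n - s by omega] at e2
  push_cast [Nat.cast_sub h.le, Nat.cast_sub (show j ≤ n by omega),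
    Nat.cast_sub (show j ≤ n + 1 by omega)] at e1 e2
  have hjn : (j : ℝ) < n := by exact_mod_cast (by omega : j < n)
  have hpos : (0 : ℝ) < n + 1 - j := by linarith
  refine le_of_mul_le_mul_left ?_ hpos
  have key : ((n : ℝ) + 1 - j) * ((n - s) * ((n + 1).choose j * (n - j).choose (s - j))) =
      (n + 1) * (n - j) * (n.choose j * (n - 1 - j).choose (s - j)) := by
    linear_combination (-((n : ℝ) - s) * (n - j).choose (s - j)) * e1
      - ((n : ℝ) + 1) * n.choose j * e2
  have : ((n : ℝ) + 1) * (n - j) ≤ (n + 1 - j) * n := by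
    nlinarith [(Nat.cast_nonneg j : (0 : ℝ) ≤ j)]
  rw [key, ← mul_assoc _ (n : ℝ)]
  exact mul_le_mul_of_nonneg_right this (by positivity)

lemma truncated_binomial_le_pow {r : ℝ} {s n : ℕ} (hr : (s : ℝ) + 1 ≤ r) (h : s + 2 ≤ n) :
    (-1) ^ s * ∑ i ∈ range (s + 1), (n.choose i : ℝ) * (-(1 + r)) ^ i ≤ r ^ n := by
  have hr0 : 0 ≤ r := by have := (Nat.cast_nonneg s : (0 : ℝ) ≤ s); linarith
  induction n, h using Nat.le_induction with
  | base =>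
    have full := add_pow (-(1 + r)) 1 (s + 2)
    rw [sum_range_succ, sum_range_succ] at full
    simp only [one_pow, mul_one, Nat.choose_self, Nat.choose_succ_self_right] at full
    have hs : ∑ i ∈ range (s + 1), ((s + 2).choose i : ℝ) * (-(1 + r)) ^ i =
        (-r) ^ (s + 2) - (-(1 + r)) ^ (s + 1) * (s + 2) - (-(1 + r)) ^ (s + 2) := by
      rw [show -(1 + r) + 1 = -r by ring] at full
      rw [full]
      push_cast
      simp_rw [mul_comm]
      ring
    have sgn : (-1 : ℝ) ^ s * (-1) ^ s = 1 := by rw [← mul_pow]; simp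
    have : (-1) ^ s * ∑ i ∈ range (s + 1), ((s + 2).choose i : ℝ) * (-(1 + r)) ^ i =
        r ^ (s + 2) + (1 + r) ^ (s + 1) * (s + 1 - r) := by
      rw [hs, neg_pow r, neg_pow (1 + r), neg_pow (1 + r) (s + 2)]
      simp only [pow_succ]
      linear_combination (r ^ s * r * r + (1 + r) ^ s * (1 + r) * (s + 1 - r)) * sgn
    rw [this]
    nlinarith [pow_nonneg (by linarith : (0 : ℝ) ≤ 1 + r) (s + 1)]
  | succ n hn ih =>
    rw [truncated_binomial_eq_sum_pow r (by omega)] at ih ⊢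
    have hsn : (s : ℝ) + 2 ≤ n := by exact_mod_cast hn
    have step : ((n : ℝ) - s) * ∑ j ∈ range (s + 1),
          ((n + 1).choose j : ℝ) * ((n + 1 - 1 - j).choose (s - j) : ℝ) * r ^ j ≤
        n * ∑ j ∈ range (s + 1),
          (n.choose j : ℝ) * ((n - 1 - j).choose (s - j) : ℝ) * r ^ j := by
      rw [mul_sum, mul_sum]
      refine sum_le_sum fun j hj => ?_
      rw [Nat.add_sub_cancel, ← mul_assoc, ← mul_assoc (n : ℝ)]
      exact mul_le_mul_of_nonneg_right
        (choose_mul_choose_succ_le (s := s) (n := n) (Nat.lt_succ_iff.1 (mem_range.1 hj)) (by omega)) (pow_nonneg hr0 j)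
    have hpos : (0 : ℝ) < n - s := by linarith
    refine le_of_mul_le_mul_left (step.trans ?_) hpos
    -- The growth factor `n / (n - s)` is at most `r`, so the induction closes.
    have : (n : ℝ) ≤ (n - s) * r := by
      nlinarith [(Nat.cast_nonneg s : (0 : ℝ) ≤ s)]
    calc _ ≤ (n : ℝ) * r ^ n := by gcongr
      _ ≤ (n - s) * r * r ^ n := by gcongr
      _ = _ := by ring

lemma truncated_binomial_div_le_one {r : ℝ} {s : ℕ} (hr : (s : ℝ) + 1 ≤ r) (n : ℕ) :
    (∑ i ∈ range (s + 1), (n.choose i : ℝ) * (-(1 + r)) ^ i) * (-1 / r) ^ n ≤ 1 := by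
  have hr0 : 0 < r := by have := (Nat.cast_nonneg s : (0 : ℝ) ≤ s); linarith
  have inv : (-r) ^ n * (-1 / r) ^ n = 1 := by
    rw [← mul_pow, show -r * (-1 / r) = 1 by field_simp, one_pow]
  have full := add_pow (-(1 + r)) 1 n
  rw [show -(1 + r) + 1 = -r by ring] at full
  rcases Nat.lt_trichotomy n (s + 1) with h | rfl | h
  · have : ∑ i ∈ range (s + 1), (n.choose i : ℝ) * (-(1 + r)) ^ i = (-r) ^ n := by
      rw [full, ← sum_subset (range_subset_range.2 (show n + 1 ≤ s + 1 by omega))]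
      · exact sum_congr rfl fun i _ => by simp [mul_comm]
      · intro i _ hi
        rw [Nat.choose_eq_zero_of_lt (by simpa using hi)]; simp
    rw [this, inv]
  · rw [sum_range_succ] at full
    have : ∑ i ∈ range (s + 1), ((s + 1).choose i : ℝ) * (-(1 + r)) ^ i =
        (-r) ^ (s + 1) - (-(1 + r)) ^ (s + 1) := by
      rw [full]; simp [mul_comm]
    rw [this, sub_mul, inv, ← mul_pow]
    have : 0 ≤ (-(1 + r) * (-1 / r)) ^ (s + 1) := by
      apply pow_nonneg
      rw [show -(1 + r) * (-1 / r) = (1 + r) / r by ring]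
      positivity
    linarith
  · set S := ∑ i ∈ range (s + 1), (n.choose i : ℝ) * (-(1 + r)) ^ i with hS
    have upper : (-1) ^ s * S ≤ r ^ n := truncated_binomial_le_pow hr (by omega)
    have lower : 0 ≤ (-1) ^ s * S := by
      rw [hS, truncated_binomial_eq_sum_pow r (by omega)]
      positivity
    have hn : 0 < r ^ n := by positivity
    rw [div_pow, mul_div_assoc', div_le_one hn]
    rcases neg_one_pow_eq_or ℝ s with e | e <;> rcases neg_one_pow_eq_or ℝ n with e' | e' <;>
      rw [e] at upper lower <;> rw [e'] <;> linarith

/-! ### Polynomials with a zero of high order -/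

/-- This is the vanishing of the `i`-th Hasse derivative at `a`, scaled by `a ^ i`. -/
lemma sum_coeff_mul_choose_eq_zero {W : ℝ[X]} {a : ℝ} {t : ℕ} (h : (X - C a) ^ t ∣ W) {i : ℕ}
    (hi : i < t) :
    ∑ k ∈ range (W.natDegree + 1), W.coeff k * (k.choose i : ℝ) * a ^ k = 0 := by
  have hz : (hasseDeriv i W).eval a = 0 := by
    obtain ⟨U, rfl⟩ := h
    rw [← taylor_coeff, taylor_mul, taylor_pow]
    simp only [map_sub, taylor_X, taylor_C, add_sub_cancel_right]
    rw [coeff_X_pow_mul', if_neg (by omega)]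
  rw [hasseDeriv_apply, sum_over_range _ (by simp), eval_finsetSum] at hz
  rw [← zero_mul (a ^ i), ← hz, sum_mul]
  refine sum_congr rfl fun k _ => ?_
  rw [eval_monomial]
  rcases le_or_gt i k with hik | hik
  · rw [mul_assoc _ (a ^ (k - i)), ← pow_add, Nat.sub_add_cancel hik]; ring
  · simp [Nat.choose_eq_zero_of_lt hik]

/-- The binomial coefficient `(k - 1).choose i`, extended to `k = 0` as a polynomial in `k`. -/
noncomputable def predChoose (k i : ℕ) : ℝ :=
  if k = 0 then (-1) ^ i else ((k - 1).choose i : ℝ)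

lemma predChoose_add (k i : ℕ) :
    predChoose k (i + 1) + predChoose k i = (k.choose (i + 1) : ℝ) := by
  cases k with
  | zero => simp [predChoose, pow_succ]
  | succ k => simp [predChoose, Nat.choose_succ_succ, add_comm]

lemma sum_coeff_mul_predChoose_eq_zero {W : ℝ[X]} {a : ℝ} {t : ℕ} (h : (X - C a) ^ t ∣ W) {i : ℕ}
    (hi : i < t) :
    ∑ k ∈ range (W.natDegree + 1), W.coeff k * predChoose k i * a ^ k = 0 := by
  induction i with
  | zero =>
    rw [← sum_coeff_mul_choose_eq_zero h hi]
    refine sum_congr rfl fun k _ => ?_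
    simp [predChoose]
  | succ i ih =>
    rw [← sum_coeff_mul_choose_eq_zero h hi, ← sub_eq_zero, ← sum_sub_distrib,
      ← neg_eq_zero, ← ih (by omega), ← sum_neg_distrib]
    refine sum_congr rfl fun k _ => ?_
    rw [← predChoose_add]; ring

/-- A polynomial with nonnegative coefficients and a zero of order `t ≤ r` at `-1 / r` grows by a
factor of at least `(1 + r) ^ t` from `0` to `1`. -/
lemma pow_mul_eval_zero_le_eval_one {W : ℝ[X]} {r : ℝ} {t : ℕ} (ht : 0 < t) (hr : (t : ℝ) ≤ r)
    (hW : ∀ k, 0 ≤ W.coeff k) (h : (X - C (-1 / r)) ^ t ∣ W) :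
    (1 + r) ^ t * W.eval 0 ≤ W.eval 1 := by
  obtain ⟨s, rfl⟩ : ∃ s, t = s + 1 := ⟨t - 1, by omega⟩
  have hr' : (s : ℝ) + 1 ≤ r := by exact_mod_cast hr
  have hr0 : 0 < r := by have := (Nat.cast_nonneg s : (0 : ℝ) ≤ s); linarith
  -- A dual certificate: a combination of the vanishing sums whose weight on `W.coeff k` is `1 - (1
  -- + r) ^ t` at `k = 0` and at most `1` for `k ≥ 1`. The inner sum truncates the expansion of `(1
  -- - (1 + r)) ^ (k - 1)`.
  have vanish : ∑ k ∈ range (W.natDegree + 1), W.coeff k *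
      (-r * (∑ i ∈ range (s + 1), predChoose k i * (-(1 + r)) ^ i) * (-1 / r) ^ k) = 0 := by
    calc _ = ∑ i ∈ range (s + 1), -r * (-(1 + r)) ^ i *
          ∑ k ∈ range (W.natDegree + 1), W.coeff k * predChoose k i * (-1 / r) ^ k := by
          simp_rw [mul_sum, sum_mul, mul_sum]
          rw [sum_comm]
          exact sum_congr rfl fun i _ => sum_congr rfl fun k _ => by ring
      _ = 0 := sum_eq_zero fun i hi => by
          rw [sum_coeff_mul_predChoose_eq_zero h (mem_range.1 hi), mul_zero]
  have zero : -r * (∑ i ∈ range (s + 1), predChoose 0 i * (-(1 + r)) ^ i) * (-1 / r) ^ 0 =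
      1 - (1 + r) ^ (s + 1) := by
    have geom := geom_sum_mul (1 + r) (s + 1)
    have : ∀ i ∈ range (s + 1), predChoose 0 i * (-(1 + r)) ^ i = (1 + r) ^ i := fun i _ => by
      rw [predChoose, if_pos rfl, ← mul_pow]; simp
    rw [sum_congr rfl this]
    linear_combination -geom
  have pos : ∀ k, -r * (∑ i ∈ range (s + 1), predChoose (k + 1) i * (-(1 + r)) ^ i) *
      (-1 / r) ^ (k + 1) ≤ 1 := fun k => by
    have hk : -r * (-1 / r) = 1 := by field_simp
    convert truncated_binomial_div_le_one hr' k using 1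
    simp only [predChoose, Nat.add_eq_zero_iff, one_ne_zero, and_false, if_false,
      Nat.add_sub_cancel, pow_succ]
    linear_combination (∑ i ∈ range (s + 1), (k.choose i : ℝ) * (-(1 + r)) ^ i) *
      (-1 / r) ^ k * hk
  rw [sum_range_succ', zero] at vanish
  rw [eval_eq_sum_range, eval_eq_sum_range, sum_range_succ', sum_range_succ']
  have := sum_le_sum fun k (_ : k ∈ range W.natDegree) =>
    mul_le_mul_of_nonneg_left (pos k) (hW (k + 1))
  simp only [mul_one, one_pow, pow_zero, ne_eq, Nat.add_eq_zero_iff, one_ne_zero, and_false,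
    not_false_eq_true, zero_pow, mul_zero, sum_const_zero, zero_add] at this ⊢
  linarith

/-! ### Biased measure of intersecting families -/

section
variable {V : Type*} [Fintype V] [DecidableEq V]

/-- The probability of `A` under the `p`-biased product measure on subsets of a finite type. -/
noncomputable def biasedWeight (p : ℝ) (A : Finset V) : ℝ :=
  ∏ v, if v ∈ A then p else 1 - p

/-- The sign of a vertex relative to a set. -/
noncomputable def memSign (A : Finset V) (v : V) : ℝ := if v ∈ A then 1 else -1

/-- The joint weight of a pair of sets, where `X` stands for the correlation. -/
noncomputable def pairWeight (p : ℝ) (A B : Finset V) : ℝ[X] :=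
  ∏ v, (C (p * (1 - p) * (memSign A v * memSign B v)) * X +
    C ((if v ∈ A then p else 1 - p) * (if v ∈ B then p else 1 - p)))

lemma eval_zero_pairWeight (p : ℝ) (A B : Finset V) :
    (pairWeight p A B).eval 0 = biasedWeight p A * biasedWeight p B := by
  simp [pairWeight, biasedWeight, eval_prod, ← prod_mul_distrib, -mul_ite, -ite_mul]

lemma eval_one_pairWeight (p : ℝ) (A B : Finset V) :
    (pairWeight p A B).eval 1 = if A = B then biasedWeight p A else 0 := by
  rw [pairWeight, eval_prod]
  split_ifs with h
  · subst h
    refine prod_congr rfl fun v _ => ?_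
    by_cases hv : v ∈ A <;> simp [memSign, hv] <;> ring
  · obtain ⟨v, hv⟩ : ∃ v, ¬(v ∈ A ↔ v ∈ B) := by
      by_contra! hc
      exact h (Finset.ext hc)
    refine prod_eq_zero (mem_univ v) ?_
    by_cases hA : v ∈ A <;> by_cases hB : v ∈ B <;> simp [memSign, hA, hB] at hv ⊢ <;> ring

/-- A vertex in both sets contributes `p ^ 2 + p * (1 - p) * X`, which vanishes at `X = -p / (1 -
p)`. -/
lemma pow_dvd_pairWeight {p : ℝ} (hp : 0 < p) (hp1 : p < 1) (A B : Finset V) :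
    (X - C (-1 / ((1 - p) / p))) ^ (A ∩ B).card ∣ pairWeight p A B := by
  rw [pairWeight, ← prod_const]
  refine (prod_dvd_prod_of_dvd _ _ fun v hv => ?_).trans
    (prod_dvd_prod_of_subset _ _ _ (subset_univ (A ∩ B)))
  rw [mem_inter] at hv
  have hq : 1 - p ≠ 0 := by linarith
  refine ⟨C (p * (1 - p)), ?_⟩
  have : p * p = -(-1 / ((1 - p) / p) * (p * (1 - p))) := by field_simp
  simp only [memSign, hv.1, hv.2, if_true, mul_one]
  rw [this, sub_mul, ← C_mul, C_neg]
  ring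

lemma pairWeight_eq_sum (p : ℝ) (A B : Finset V) :
    pairWeight p A B = ∑ S : Finset V, C ((p * (1 - p)) ^ S.card *
      (((∏ v ∈ S, memSign A v) * ∏ v ∈ Sᶜ, if v ∈ A then p else 1 - p) *
        ((∏ v ∈ S, memSign B v) * ∏ v ∈ Sᶜ, if v ∈ B then p else 1 - p))) * X ^ S.card := by
  rw [pairWeight, Fintype.prod_add]
  refine sum_congr rfl fun S _ => ?_
  simp only [prod_mul_distrib, prod_const, C_mul, C_pow, map_prod]
  ring

/-- Expanding the product over `v`, the term of each `S` factors into a part from `A` and the same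
part from `B`; summing over `F × F` gives a square. -/
lemma coeff_sum_pairWeight_nonneg {p : ℝ} (hp : 0 < p) (hp1 : p < 1) (F : Finset (Finset V))
    (k : ℕ) : 0 ≤ (∑ A ∈ F, ∑ B ∈ F, pairWeight p A B).coeff k := by
  have : ∑ A ∈ F, ∑ B ∈ F, pairWeight p A B = ∑ S : Finset V, C ((p * (1 - p)) ^ S.card *
      (∑ A ∈ F, (∏ v ∈ S, memSign A v) * ∏ v ∈ Sᶜ, if v ∈ A then p else 1 - p) ^ 2) *
        X ^ S.card := by
    simp_rw [pairWeight_eq_sum, sq, sum_mul_sum, mul_sum, map_sum, sum_mul]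
    exact (sum_congr rfl fun A _ => sum_comm).trans sum_comm
  rw [this, finsetSum_coeff]
  refine sum_nonneg fun S _ => ?_
  rw [coeff_C_mul_X_pow]
  have : 0 < 1 - p := by linarith
  split_ifs <;> positivity

/-- A `t`-intersecting family has `p`-biased measure at most `p ^ t` when `p ≤ 1 / (t + 1)`. -/
theorem sum_biasedWeight_le_pow {p : ℝ} {t : ℕ} (ht : 0 < t) (hp : 0 < p)
    (hpt : p * (t + 1) ≤ 1) (F : Finset (Finset V))
    (hF : ∀ A ∈ F, ∀ B ∈ F, t ≤ (A ∩ B).card) : ∑ A ∈ F, biasedWeight p A ≤ p ^ t := by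
  have ht1 : (1 : ℝ) ≤ t := by exact_mod_cast ht
  have hp1 : p < 1 := by nlinarith
  set m := ∑ A ∈ F, biasedWeight p A with hm
  have hr : (t : ℝ) ≤ (1 - p) / p := by rw [le_div_iff₀ hp]; linarith
  have key := pow_mul_eval_zero_le_eval_one ht hr (coeff_sum_pairWeight_nonneg hp hp1 F)
    (dvd_sum fun A hA => dvd_sum fun B hB =>
      (pow_dvd_pow _ (hF A hA B hB)).trans (pow_dvd_pairWeight hp hp1 A B))
  simp only [eval_finsetSum, eval_zero_pairWeight, eval_one_pairWeight, ← sum_mul_sum,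
    sum_ite_eq] at key
  rw [sum_congr rfl fun A hA => if_pos hA, ← hm, show 1 + (1 - p) / p = p⁻¹ by field_simp; ring,
    inv_pow, inv_mul_le_iff₀ (by positivity)] at key
  rcases le_or_gt m 0 with h | h
  · exact h.trans (by positivity)
  · exact le_of_mul_le_mul_right key h
end

/-! ### Random colorings -/

lemma card_coloring_fiber {V : Type*} [Fintype V] [DecidableEq V] {ℓ : ℕ} (hℓ : 0 < ℓ)
    (K : Finset (Fin ℓ)) (A : Finset V) :
    (({f : V → Fin ℓ | ({v | f v ∈ K} : Finset V) = A} : Finset (V → Fin ℓ)).card : ℝ) =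
      ℓ ^ Fintype.card V * biasedWeight ((K.card : ℝ) / ℓ) A := by
  have hℓ' : (ℓ : ℝ) ≠ 0 := by positivity
  have : ({f : V → Fin ℓ | ({v | f v ∈ K} : Finset V) = A} : Finset (V → Fin ℓ)) =
      Fintype.piFinset fun v => if v ∈ A then K else Kᶜ := by
    ext f
    simp only [mem_filter, mem_univ, true_and, Fintype.mem_piFinset, Finset.ext_iff]
    refine forall_congr' fun v => ?_
    by_cases hv : v ∈ A <;> simp [hv]
  rw [this, Fintype.card_piFinset, Nat.cast_prod, biasedWeight, ← card_univ, ← prod_const,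
    ← prod_mul_distrib]
  refine prod_congr rfl fun v _ => ?_
  split_ifs
  · field_simp
  · rw [card_compl, Fintype.card_fin, Nat.cast_sub (by simpa using card_le_univ K)]
    field_simp

/-- Union bound over the sets of `k` colors, for a `t`-intersecting family of vertex sets. -/
lemma exists_coloring_forall_notMem {V : Type*} [Fintype V] [DecidableEq V] {ℓ k t : ℕ}
    (hk : 0 < k) (ht : 0 < t) (hℓ : k * (t + 1) ≤ ℓ)
    (hlt : (ℓ.choose k : ℝ) * ((k : ℝ) / ℓ) ^ t < 1) (F : Finset (Finset V))
    (hF : ∀ A ∈ F, ∀ B ∈ F, t ≤ (A ∩ B).card) :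
    ∃ f : V → Fin ℓ, ∀ K : Finset (Fin ℓ), K.card = k → ({v | f v ∈ K} : Finset V) ∉ F := by
  by_contra! hcon
  have hℓ0 : 0 < ℓ := lt_of_lt_of_le (by positivity) hℓ
  have hℓ' : (0 : ℝ) < ℓ := by exact_mod_cast hℓ0
  have hk' : (0 : ℝ) < k := by exact_mod_cast hk
  have cover : (univ : Finset (V → Fin ℓ)) ⊆ (powersetCard k univ).biUnion fun K =>
      F.biUnion fun A => {f | ({v | f v ∈ K} : Finset V) = A} := fun f _ => by
    obtain ⟨K, hK, hKF⟩ := hcon f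
    simp only [mem_biUnion, mem_powersetCard_univ, mem_filter, mem_univ, true_and]
    exact ⟨K, hK, _, hKF, rfl⟩
  have bound : Fintype.card (V → Fin ℓ) ≤ ∑ K ∈ powersetCard k (univ : Finset (Fin ℓ)),
      ∑ A ∈ F, ({f | ({v | f v ∈ K} : Finset V) = A} : Finset (V → Fin ℓ)).card :=
    (card_le_card cover).trans (card_biUnion_le.trans (sum_le_sum fun K _ => card_biUnion_le))
  have bound' : (ℓ : ℝ) ^ Fintype.card V ≤ ∑ K ∈ powersetCard k (univ : Finset (Fin ℓ)),
      (ℓ : ℝ) ^ Fintype.card V * ((k : ℝ) / ℓ) ^ t := by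
    have := Nat.cast_le (α := ℝ).2 bound
    rw [Fintype.card_fun, Fintype.card_fin] at this
    push_cast at this
    refine this.trans (sum_le_sum fun K hK => ?_)
    rw [sum_congr rfl fun A _ => card_coloring_fiber hℓ0 K A, ← mul_sum,
      mem_powersetCard_univ.1 hK]
    gcongr
    refine sum_biasedWeight_le_pow ht (by positivity) ?_ F hF
    rw [div_mul_eq_mul_div, div_le_one hℓ']
    exact_mod_cast hℓ
  rw [sum_const, card_powersetCard, card_univ, Fintype.card_fin, nsmul_eq_mul] at bound'
  have : 0 < (ℓ : ℝ) ^ Fintype.card V := by positivity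
  nlinarith

lemma encard_preimage_edge {α : Type*} {G : Hypergraph α} {e : Set α} (he : e ∈ G.edgeSet) :
    {v : G.vertexSet | (v : α) ∈ e}.encard = e.encard := by
  rw [← Subtype.val_injective.encard_image]
  congr 1
  ext v
  simpa using fun hv => G.subset_vertexSet_of_mem_edgeSet he hv

lemma strongColorable_of_subsingleton {α : Type*} {G : Hypergraph α} (hV : G.vertexSet.Finite)
    (hG : G.edgeSet.Subsingleton) {c ℓ : ℕ} (hℓ : 0 < ℓ) (hc : c ≤ ℓ) :
    StrongColorable c ℓ G := by
  have : Nonempty (Fin ℓ) := ⟨⟨0, hℓ⟩⟩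
  have := hV.to_subtype
  rcases hG.eq_empty_or_singleton with h | ⟨e, h⟩
  · exact ⟨fun _ => ⟨0, hℓ⟩, fun e he => by simp [h] at he⟩
  · have he : e ∈ G.edgeSet := by simp [h]
    obtain ⟨s, hs, hcard⟩ := Set.exists_subset_encard_eq
      ((min_le_right (c : ℕ∞) _).trans (encard_preimage_edge he).ge)
    obtain ⟨f, -, hf⟩ := (Set.toFinite s).exists_injOn_of_encard_le
      (t := (Set.univ : Set (Fin ℓ))) (by
        rw [hcard]
        refine (min_le_left _ _).trans ?_
        simpa using hc)
    refine ⟨f, fun e' he' => ?_⟩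
    obtain rfl : e' = e := by simpa [h] using he'
    rw [← hcard, ← hf.encard_image]
    exact Set.encard_le_encard (Set.image_mono hs)

theorem strongColorable_of_choose_mul_pow_lt_one {α : Type*} {G : Hypergraph α}
    (hV : G.vertexSet.Finite) {t c ℓ : ℕ} (hG : IsIntersecting t G) (hc : 2 ≤ c) (ht : 0 < t)
    (hℓ : (c - 1) * (t + 1) < ℓ)
    (hlt : (ℓ.choose (c - 1) : ℝ) * (((c : ℝ) - 1) / (ℓ : ℝ)) ^ t < 1) :
    StrongColorable c ℓ G := by
  classical
  have hcℓ : c ≤ ℓ := by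
    have := Nat.le_mul_of_pos_right (c - 1) (by omega : 0 < t + 1)
    omega
  rcases G.edgeSet.subsingleton_or_nontrivial with h | h
  · exact strongColorable_of_subsingleton hV h (by omega) hcℓ
  have inter : ∀ e ∈ G.edgeSet, ∀ e' ∈ G.edgeSet, (t : ℕ∞) ≤ (e ∩ e').encard := by
    intro e he e' he'
    by_cases hee : e = e'
    · obtain ⟨d, hd, hde⟩ := h.exists_ne e
      rw [← hee, Set.inter_self]
      exact (hG he hd hde.symm).trans (Set.encard_le_encard Set.inter_subset_left)
    · exact hG he he' hee
  have := hV.fintype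
  let F : Finset (Finset G.vertexSet) :=
    {A | ∃ e ∈ G.edgeSet, ∀ v : G.vertexSet, (v : α) ∈ e → v ∈ A}
  have hF : ∀ A ∈ F, ∀ B ∈ F, t ≤ (A ∩ B).card := by
    intro A hA B hB
    obtain ⟨e, he, heA⟩ := (mem_filter.1 hA).2
    obtain ⟨e', he', heB⟩ := (mem_filter.1 hB).2
    have sub : e ∩ e' ⊆ Subtype.val '' ((A ∩ B : Finset G.vertexSet) : Set G.vertexSet) :=
      fun v hv => ⟨⟨v, G.subset_vertexSet_of_mem_edgeSet he hv.1⟩,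
        by simpa using ⟨heA _ hv.1, heB _ hv.2⟩, rfl⟩
    have := (inter e he e' he').trans (Set.encard_le_encard sub)
    rw [Subtype.val_injective.encard_image, Set.encard_coe_eq_coe_finsetCard] at this
    exact_mod_cast this
  obtain ⟨f, hf⟩ := exists_coloring_forall_notMem (by omega : 0 < c - 1) ht hℓ.le
    (by rwa [Nat.cast_sub (by omega), Nat.cast_one]) F hF
  refine ⟨f, fun e he => (min_le_left _ _).trans ?_⟩
  by_contra! hlt
  have hcard : (f '' {v | (v : α) ∈ e}).toFinset.card ≤ c - 1 := by
    rw [Set.encard_eq_coe_toFinset_card, Nat.cast_lt] at hlt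
    omega
  -- Pad the colors seen on `e` to exactly `c - 1`, so that the preimage of `K` contains `e`.
  obtain ⟨K, hK, hKc⟩ := exists_superset_card_eq hcard (by simp; omega)
  refine hf K hKc (mem_filter.2 ⟨mem_univ _, e, he, fun v hv => ?_⟩)
  exact mem_filter.2 ⟨mem_univ _, hK (by simpa using ⟨v, hv, v.2, rfl⟩)⟩

/-! ### The choice `ℓ = t ^ t` -/

lemma pred_mul_succ_lt_pow_self {t c : ℕ} (hc : 2 ≤ c) (hct : c ≤ t) :
    (c - 1) * (t + 1) < t ^ t := by
  obtain ⟨s, rfl⟩ : ∃ s, t = s + 1 := ⟨t - 1, by omega⟩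
  calc (c - 1) * (s + 1 + 1) ≤ s * (s + 1 + 1) := Nat.mul_le_mul_right _ (by omega)
    _ < (s + 1) ^ 2 := by nlinarith
    _ ≤ (s + 1) ^ (s + 1) := Nat.pow_le_pow_right (by omega) (by omega)

/-- With `N = t ^ t`, the binomial is at most `N ^ (c - 1)` and `(c - 1) ^ t < N`, so the product is
below `N ^ c ≤ N ^ t`. -/
lemma choose_pow_self_mul_lt_one {t c : ℕ} (hc : 2 ≤ c) (hct : c ≤ t) :
    ((t ^ t).choose (c - 1) : ℝ) * (((c : ℝ) - 1) / ((t ^ t : ℕ) : ℝ)) ^ t < 1 := by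
  obtain ⟨k, rfl⟩ : ∃ k, c = k + 1 := ⟨c - 1, by omega⟩
  rw [Nat.add_sub_cancel, Nat.cast_add_one, add_sub_cancel_right, div_pow, mul_div_assoc']
  have hN : 0 < t ^ t := Nat.pow_pos (by omega)
  rw [div_lt_one (by positivity)]
  have : (t ^ t).choose k * k ^ t < (t ^ t) ^ t := by
    calc (t ^ t).choose k * k ^ t ≤ (t ^ t) ^ k * k ^ t :=
          Nat.mul_le_mul_right _ (Nat.choose_le_pow _ _)
      _ < (t ^ t) ^ k * t ^ t :=
          Nat.mul_lt_mul_of_pos_left (Nat.pow_lt_pow_left (by omega) (by omega)) (by positivity)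
      _ = (t ^ t) ^ (k + 1) := (pow_succ _ _).symm
      _ ≤ (t ^ t) ^ t := Nat.pow_le_pow_right hN (by omega)
  exact_mod_cast this

lemma chi_le {t c k : ℕ} (h : Suffices t c k) : chi t c ≤ k := iInf₂_le k h

end SemiStrong

theorem mainTheorem1 (t c : ℕ) (hc : 2 ≤ c) (hct : c ≤ t) :
    (∀ ℓ : ℕ, (c - 1) * (t + 1) < ℓ →
      (ℓ.choose (c - 1) : ℝ) * (((c : ℝ) - 1) / (ℓ : ℝ)) ^ t < 1 →
        (∀ (α : Type*) (G : Hypergraph α), G.vertexSet.Finite →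
          SemiStrong.IsIntersecting t G → SemiStrong.StrongColorable c ℓ G) ∧
        SemiStrong.chi t c ≤ (ℓ : ℕ∞)) ∧
    ((c - 1) * (t + 1) < t ^ t ∧
      ((t ^ t).choose (c - 1) : ℝ) * (((c : ℝ) - 1) / ((t ^ t : ℕ) : ℝ)) ^ t < 1) ∧
    SemiStrong.chi t c < ⊤ := by
  have color : ∀ ℓ : ℕ, (c - 1) * (t + 1) < ℓ →
      (ℓ.choose (c - 1) : ℝ) * (((c : ℝ) - 1) / (ℓ : ℝ)) ^ t < 1 →
        SemiStrong.chi t c ≤ (ℓ : ℕ∞) := fun ℓ h₁ h₂ => SemiStrong.chi_le fun α G hV hG =>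
    SemiStrong.strongColorable_of_choose_mul_pow_lt_one hV hG hc (by omega) h₁ h₂
  have h₁ := SemiStrong.pred_mul_succ_lt_pow_self hc hct
  have h₂ := SemiStrong.choose_pow_self_mul_lt_one hc hct
  exact ⟨fun ℓ hℓ hlt => ⟨fun α G hV hG =>
    SemiStrong.strongColorable_of_choose_mul_pow_lt_one hV hG hc (by omega) hℓ hlt,
    color ℓ hℓ hlt⟩, ⟨h₁, h₂⟩, (color _ h₁ h₂).trans_lt (ENat.natCast_lt_top _)⟩
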